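/- Let $m\ge 4$ and let $L_m$ be the $(m-2)\times\frac{m(m-3)}{2}$ complex matrix consisting of $m-3$ consecutive blocks of sizes $(m-2)\times k$, $k=2,\ldots,m-2$, where the block of width $k$ has $k$-th row $(1,\ldots,1)$, entries $-1$ in positions $(i,i+1)$ for $1\le i\le k-1$, and zeros elsewhere. Equivalently, the entries $\ell_0(x),\ldots,\ell_n(x)$ of $(1,x_1,\ldots,x_{m-3})\cdot L_m$, where $n=\frac{m(m-3)}{2}-1$, are the affine-linear functions $x_j$ and $x_j-1$ for $1\le j\le m-3$, and $x_j-x_i$ for $1\le i<j\le m-3$, so that the complement $X=\{x\in\mathbb{C}^{m-3} : \ell_0(x)\cdots\ell_n(x)\ne 0\}$ is isomorphic to $\mathcal{M}_{0,m}$. Let $\mathcal{R}_{L_m}\subset\mathbb{P}^n$ be the associated reciprocal linear space, i.e. the closure in complex projective space $\mathbb{P}^n$ of the image of the map $X\to\mathbb{P}^n$, $x\mapsto(\ell_0(x)^{-1}:\cdots:\ell_n(x)^{-1})$. Then $$\deg\mathcal{R}_{L_m}=(m-3)\,(m-3)!.$$ Here the degree of a projective variety is $d!$ times the leading coefficient of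 its Hilbert polynomial, where $d$ is the degree of that polynomial (equivalently, the dimension of the variety). -/

import Mathlib

namespace ScatteringArrangement

noncomputable section

/-! ### Projective sets, Hilbert polynomial and degree -/

section Projective

variable {ι : Type*}

/-- The Zariski closure of a subset `V` of the projective space with homogeneous coordinates
indexed by `ι`: all points at which every form that vanishes on `V` vanishes. (Whether a form
vanishes at a point does not depend on the representative of the point.) -/
def zariskiClosure (V : Set (Projectivization ℂ (ι → ℂ))) :
    Set (Projectivization ℂ (ι → ℂ)) :=
  {p | ∀ (q : ℕ) (f : MvPolynomial ι ℂ), f.IsHomogeneous q →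
    (∀ v ∈ V, MvPolynomial.eval v.rep f = 0) → MvPolynomial.eval p.rep f = 0}

/-- All homogeneous coordinate vectors of all points of `V`. -/
def coneOver (V : Set (Projectivization ℂ (ι → ℂ))) : Set (ι → ℂ) :=
  {v | ∃ hv : v ≠ 0, Projectivization.mk ℂ v hv ∈ V}

/-- The homogeneous vanishing ideal `I(V)`: the polynomials that vanish at all homogeneous
coordinate vectors of all points of `V`. As `ℂ` is infinite, a polynomial does so if and only if
each of its homogeneous components vanishes on `V`. -/
def homogeneousIdeal (V : Set (Projectivization ℂ (ι → ℂ))) : Ideal (MvPolynomial ι ℂ) :=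
  MvPolynomial.vanishingIdeal ℂ (coneOver V)

/-- The Hilbert function of the homogeneous coordinate ring `ℂ[V] = ℂ[y] / I(V)`: the dimension
of the image in `ℂ[V]` of the space of forms of degree `q`. -/
def hilbertFunction (V : Set (Projectivization ℂ (ι → ℂ))) (q : ℕ) : ℕ :=
  Module.finrank ℂ ((MvPolynomial.homogeneousSubmodule ι ℂ q).map
    (Ideal.Quotient.mkₐ ℂ (homogeneousIdeal V)).toLinearMap)

open Classical in
/-- The Hilbert polynomial of `V`: the (unique) polynomial that agrees with the Hilbert function
at all sufficiently large `q`. It exists for all `V` when `ι` is finite; `0` is only a default. -/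
def hilbertPolynomial (V : Set (Projectivization ℂ (ι → ℂ))) : Polynomial ℚ :=
  if h : ∃ P : Polynomial ℚ, ∀ᶠ q : ℕ in Filter.atTop,
      (hilbertFunction V q : ℚ) = P.eval (q : ℚ)
  then h.choose else 0

/-- The degree of a projective variety `V`: writing `d` for the degree of its Hilbert polynomial
(which is the dimension of `V`), `d!` times the leading coefficient of the Hilbert polynomial. -/
def degree (V : Set (Projectivization ℂ (ι → ℂ))) : ℚ :=
  (Nat.factorial (hilbertPolynomial V).natDegree : ℚ) * (hilbertPolynomial V).leadingCoeff

end Projective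

/-! ### Reciprocal linear spaces -/

section Reciprocal

variable {d : ℕ} {ι : Type*}

/-- The affine-linear functions `(ℓ i)` of the arrangement given by `L`:
`ℓ(x) = (1, x_1, …, x_d) * L`. -/
def affineForm (L : Matrix (Fin (d + 1)) ι ℂ) (x : Fin d → ℂ) : ι → ℂ :=
  Matrix.vecMul (Fin.cons (1 : ℂ) x : Fin (d + 1) → ℂ) L

/-- The complement of the hyperplane arrangement given by `L`. -/
def complement (L : Matrix (Fin (d + 1)) ι ℂ) : Set (Fin d → ℂ) :=
  {x | ∀ i, affineForm L x i ≠ 0}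

/-- The image of the map `x ↦ (1 / ℓ i (x))_i` from the complement of the arrangement to
projective space. -/
def reciprocalImage (L : Matrix (Fin (d + 1)) ι ℂ) : Set (Projectivization ℂ (ι → ℂ)) :=
  {p | ∃ x ∈ complement L, ∃ h : (fun i => (affineForm L x i)⁻¹) ≠ 0,
    p = Projectivization.mk ℂ (fun i => (affineForm L x i)⁻¹) h}

/-- The reciprocal linear space of `L`: the closure in projective space of the image of
`x ↦ (1 / ℓ i (x))_i`. -/
def reciprocalLinearSpace (L : Matrix (Fin (d + 1)) ι ℂ) :
    Set (Projectivization ℂ (ι → ℂ)) :=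
  zariskiClosure (reciprocalImage L)

end Reciprocal

/-! ### The arrangement of the moduli space of `m` points on the projective line -/

/-- Column labels: `m - 3` blocks, of widths `2, 3, …, m - 2`. All counting starts at `0`, so
`⟨k, j⟩` is column `j` of block `k`, which has width `k + 2`. -/
abbrev Column (m : ℕ) : Type := (k : Fin (m - 3)) × Fin ((k : ℕ) + 2)

/-- The matrix `L_m`, with `m - 2` rows (counted from `0`). The block of width `k + 2` has a row of
ones in row `k + 1`, entries `-1` on its first upper diagonal, and zeros elsewhere. So its columns
are the coefficient vectors of `x_{k+1}`, `x_{k+1} - 1` and `x_{k+1} - x_i` for `1 ≤ i ≤ k`, which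
are the non-constant `2 × 2` minors of the matrix with columns
`(1, 0), (1, 1), (1, x_1), …, (1, x_{m-3}), (0, 1)`. -/
def matrixL (m : ℕ) : Matrix (Fin (m - 3 + 1)) (Column m) ℂ :=
  fun i c =>
    if (i : ℕ) = (c.1 : ℕ) + 1 then 1
    else if (i : ℕ) + 1 = (c.2 : ℕ) then -1
    else 0

end

end ScatteringArrangement

namespace ScatteringArrangement

/-! ### Degrees from explicit Hilbert polynomials -/

/-! Put d = m - 3. Adding the points 0 and 1 to x_1, …, x_d gives d + 2 distinct points u_j, and the
affine forms become the differences u_l - u_j over the edges of the complete graph on d + 2 vertices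
minus one edge. By affine invariance, the Hilbert function at q is the dimension of the span of the
degree-q monomials in the functions 1/(u_l - u_j), with all u_j free. The larger neighbours of each
vertex form a clique, so the relation `recip_mul_recip` rewrites every monomial in standard ones,
which use at most one larger neighbour of each vertex (`recip_mul_mem`). These are independent
because partial fractions are unique (`monomFun_coeff_eq_zero`). Counting them
(`hilbertFunction_eq_card`) gives the Hilbert series ∏_j (1 + b_j t/(1 - t)), where b_j = d, d, d -
1, …, 1, 0 counts the larger neighbours of j. Without the trivial last factor this is ∏_j (1 + (b_j
- 1)t) over (1 - t)^(d+1), and the degree is the numerator at t = 1, namely ∏_j b_j = d · d!. -/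

theorem degree_eq_of_eventually {ι : Type*} (V : Set (Projectivization ℂ (ι → ℂ)))
    (P : Polynomial ℚ)
    (h : ∀ᶠ q : ℕ in Filter.atTop, (hilbertFunction V q : ℚ) = P.eval (q : ℚ)) :
    degree V = (Nat.factorial P.natDegree : ℚ) * P.leadingCoeff := by
  have hex : ∃ P : Polynomial ℚ, ∀ᶠ q : ℕ in Filter.atTop,
      (hilbertFunction V q : ℚ) = P.eval (q : ℚ) := ⟨P, h⟩
  have hP : hilbertPolynomial V = P := by
    rw [hilbertPolynomial, dif_pos hex]
    obtain ⟨N, hN⟩ := Filter.eventually_atTop.1 (hex.choose_spec.and h)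
    refine Polynomial.eq_of_infinite_eval_eq _ _
      (((Set.Ici_infinite N).image Nat.cast_injective.injOn).mono ?_)
    rintro _ ⟨q, hq, rfl⟩
    exact (hN q hq).1.symm.trans (hN q hq).2
  rw [degree, hP]

open Polynomial in
-- `hilbertPoly p (d + 1)` is a combination, with the coefficients of p, of shifted binomial
-- polynomials of degree d, each with leading coefficient 1/d!.
theorem coeff_hilbertPoly_succ (p : ℚ[X]) (d : ℕ) :
    (hilbertPoly p (d + 1)).coeff d = p.eval 1 / (d.factorial : ℚ) := by
  rw [hilbertPoly_succ, finsetSum_coeff, eval_eq_sum, Polynomial.sum, Finset.sum_div]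
  refine Finset.sum_congr rfl fun i _ => ?_
  rw [coeff_smul, coeff_preHilbertPoly_self]
  simp [div_eq_mul_inv]

open Polynomial in
theorem natDegree_hilbertPoly_succ {p : ℚ[X]} (hp : p.eval 1 ≠ 0) (d : ℕ) :
    (hilbertPoly p (d + 1)).natDegree = d := by
  refine natDegree_eq_of_le_of_coeff_ne_zero ?_ ?_
  · rw [hilbertPoly_succ]
    refine natDegree_sum_le_of_forall_le _ _ fun i _ => (natDegree_smul_le _ _).trans ?_
    rw [natDegree_preHilbertPoly]
  · rw [coeff_hilbertPoly_succ]
    exact div_ne_zero hp (by positivity)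

theorem factorial_mul_leadingCoeff_hilbertPoly {p : Polynomial ℚ} (hp : p.eval 1 ≠ 0) (d : ℕ) :
    (Nat.factorial (p.hilbertPoly (d + 1)).natDegree : ℚ) * (p.hilbertPoly (d + 1)).leadingCoeff
      = p.eval 1 := by
  rw [Polynomial.leadingCoeff, natDegree_hilbertPoly_succ hp, coeff_hilbertPoly_succ]
  field_simp

/-! ### Hilbert series as products over the vertices. -/

/-- The power series `1 + b (X + X ^ 2 + ⋯)`. -/
noncomputable def blockSeries (b : ℚ) : PowerSeries ℚ :=
  PowerSeries.mk fun e => if e = 0 then 1 else b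

theorem blockSeries_eq (b : ℚ) : blockSeries b =
    ((1 + Polynomial.C (b - 1) * Polynomial.X : Polynomial ℚ) : PowerSeries ℚ) *
      PowerSeries.invOneSubPow ℚ 1 := by
  have h : blockSeries b * (1 - PowerSeries.X) =
      ((1 + Polynomial.C (b - 1) * Polynomial.X : Polynomial ℚ) : PowerSeries ℚ) := by
    ext e
    rw [mul_sub, mul_one, map_sub, Polynomial.coeff_coe]
    rcases e with _ | _ | e
    · simp [blockSeries]
    · rw [PowerSeries.coeff_succ_mul_X]
      simp [blockSeries, Polynomial.coeff_one]
    · rw [PowerSeries.coeff_succ_mul_X]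
      simp [blockSeries, Polynomial.coeff_one]
  rw [← h, mul_assoc, ← pow_one (1 - PowerSeries.X),
    ← PowerSeries.invOneSubPow_inv_eq_one_sub_pow, Units.inv_eq_val_inv, Units.inv_mul, mul_one]

theorem blockSeries_zero : blockSeries 0 = 1 := by
  ext e
  simp [blockSeries, PowerSeries.coeff_one]

theorem prod_blockSeries_eq (r : ℕ) (b : Fin r → ℚ) :
    ∏ j, blockSeries (b j) =
      ((∏ j, (1 + Polynomial.C (b j - 1) * Polynomial.X) : Polynomial ℚ) : PowerSeries ℚ) *
        PowerSeries.invOneSubPow ℚ r := by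
  have hpow : (PowerSeries.invOneSubPow ℚ 1) ^ r = PowerSeries.invOneSubPow ℚ r := by
    induction r with
    | zero => simp [PowerSeries.invOneSubPow_zero]
    | succ r ih => rw [pow_succ, ih fun _ => 0, PowerSeries.invOneSubPow_add]
  simp_rw [blockSeries_eq]
  rw [Finset.prod_mul_distrib, Finset.prod_const, Finset.card_univ, Fintype.card_fin, ← hpow,
    Units.val_pow_eq_pow_val]
  congr 1
  simp only [← Polynomial.coeToPowerSeries.ringHom_apply, map_prod]

/-! ### Linear independence of monomials with one factor per vertex -/

/-- Injective configurations of `n` points in the complex plane. -/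
abbrev Config (n : ℕ) : Type := {u : Fin n → ℂ // Function.Injective u}

open Filter Topology Polynomial in
/-- Partial fraction expansions are unique. -/
theorem partialFraction_unique {n : ℕ} (u : Config n) (r : Fin n) (O : Finset (ℕ × Fin n))
    (hO : ∀ o ∈ O, (o.1 = 0 → o.2 = r)) (a : ℕ × Fin n → ℂ)
    (h : ∀ v : ℂ, v ∉ Set.range u.1 → ∑ o ∈ O, a o * ((u.1 o.2 - v)⁻¹) ^ o.1 = 0) :
    ∀ o ∈ O, a o = 0 := by
  have hfin : (Set.range u.1).Finite := Set.finite_range _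
  have hpos : ∀ o ∈ O, o.1 ≠ 0 → a o = 0 := by
    rintro ⟨e, l⟩ ho he
    set P : ℂ[X] := ∑ o ∈ O with o.2 = l, C (a o) * X ^ o.1 with hP
    set R : ℂ → ℂ := fun v => ∑ o ∈ O with ¬ o.2 = l, a o * ((u.1 o.2 - v)⁻¹) ^ o.1 with hR
    have hcoeff : P.coeff e = a (e, l) := by
      rw [hP, finsetSum_coeff, Finset.sum_eq_single (e, l)]
      · simp
      · rintro ⟨e', l'⟩ h1 h2
        simp only [Finset.mem_filter] at h1
        obtain ⟨_, rfl⟩ := h1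
        rw [coeff_C_mul, coeff_X_pow, if_neg, mul_zero]
        rintro rfl
        exact h2 rfl
      · intro h1
        exact (h1 (Finset.mem_filter.2 ⟨ho, rfl⟩)).elim
    have hRcont : ContinuousAt R (u.1 l) := by
      refine tendsto_finsetSum _ fun o ho => ?_
      have : u.1 o.2 - u.1 l ≠ 0 :=
        sub_ne_zero.2 fun hh => (Finset.mem_filter.1 ho).2 (u.2 hh)
      exact (continuousAt_const.mul
        (((continuousAt_const.sub continuousAt_id).inv₀ this).pow o.1))
    have hev : ∀ᶠ v in 𝓝[≠] (u.1 l), P.eval ((u.1 l - v)⁻¹) = - R v := by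
      have h1 : ∀ᶠ v in 𝓝[≠] (u.1 l), v ∉ Set.range u.1 := by
        have : (Set.range u.1 \ {u.1 l})ᶜ ∈ 𝓝 (u.1 l) :=
          (hfin.subset Set.sdiff_subset).isClosed.isOpen_compl.mem_nhds (by simp)
        filter_upwards [mem_nhdsWithin_of_mem_nhds this, self_mem_nhdsWithin] with v h1 h2 h3
        exact h1 ⟨h3, h2⟩
      filter_upwards [h1] with v hv
      have := h v hv
      rw [← Finset.sum_filter_add_sum_filter_not O (fun o => o.2 = l)] at this
      rw [eq_neg_iff_add_eq_zero, ← this, hP, eval_finsetSum]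
      congr 1
      refine Finset.sum_congr rfl fun o ho => ?_
      rw [(Finset.mem_filter.1 ho).2]
      simp
    -- A nonconstant P would blow up as v tends to u_l, whereas it agrees with -R, which has a
    -- finite limit there.
    have hdeg : ¬ 0 < P.degree := by
      intro hd
      have h1 : Tendsto (fun v : ℂ => ‖(u.1 l - v)⁻¹‖) (𝓝[≠] (u.1 l)) atTop := by
        have h2 : Tendsto (fun v : ℂ => u.1 l - v) (𝓝[≠] (u.1 l)) (𝓝[≠] 0) := by
          refine tendsto_nhdsWithin_iff.2 ⟨?_, ?_⟩
          · have : Tendsto (fun v : ℂ => u.1 l - v) (𝓝 (u.1 l)) (𝓝 (u.1 l - u.1 l)) :=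
              tendsto_const_nhds.sub tendsto_id
            rw [sub_self] at this
            exact this.mono_left nhdsWithin_le_nhds
          · filter_upwards [self_mem_nhdsWithin] with v hv
            exact sub_ne_zero.2 fun hh => hv hh.symm
        exact tendsto_norm_atTop_iff_cobounded.2 (tendsto_inv₀_nhdsNE_zero.comp h2)
      have h3 := P.tendsto_norm_atTop hd h1
      have h4 : Tendsto (fun v => ‖P.eval ((u.1 l - v)⁻¹)‖) (𝓝[≠] (u.1 l)) (𝓝 ‖- R (u.1 l)‖) := by
        refine Tendsto.congr' ?_ ((hRcont.tendsto.neg.norm).mono_left nhdsWithin_le_nhds)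
        filter_upwards [hev] with v hv
        rw [hv]
      exact not_tendsto_nhds_of_tendsto_atTop h3 _ h4
    rw [← hcoeff]
    refine coeff_eq_zero_of_degree_lt ((not_lt.1 hdeg).trans_lt ?_)
    exact_mod_cast Nat.pos_of_ne_zero he
  rintro ⟨e, l⟩ ho
  by_cases he : e = 0
  · obtain ⟨v, hv⟩ := hfin.infinite_compl.nonempty
    have hl := hO _ ho he
    have hsum := h v hv
    rw [Finset.sum_eq_single (e, l)] at hsum
    · simpa [he] using hsum
    · rintro ⟨e', l'⟩ h1 h2
      by_cases he' : e' = 0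
      · have hl' := hO _ h1 he'
        simp only at hl hl'
        exact absurd (by rw [he, he', hl, hl']) h2
      · rw [hpos _ h1 he', zero_mul]
    · exact fun h1 => absurd ho h1
  · exact hpos _ ho he

/-- Exponents and targets of a monomial with (a power of) one factor per vertex. -/
abbrev Monom (n : ℕ) : Type := (_ : Fin n →₀ ℕ) × (Fin n → Fin n)

/-- The function `1 / (u_l - u_j)`. -/
noncomputable def recip {n : ℕ} (j l : Fin n) : Config n → ℂ := fun u => (u.1 l - u.1 j)⁻¹

/-- The product of the functions `1 / (u_l - u_j) ^ e`, where `(e, l)` is attached to `j` by `i`. -/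
noncomputable def monomFun {n : ℕ} (i : Monom n) : Config n → ℂ :=
  ∏ j, recip j (i.2 j) ^ i.1 j

/-- Vertices are peeled off in increasing order. Targets are never smaller than their vertex, so
once the vertices below s are removed, u_s occurs only in the factor of s, and varying it yields a
partial fraction expansion. -/
theorem monomFun_coeff_eq_zero {n : ℕ} (S : Finset (Monom n))
    (hS : ∀ i ∈ S, ∀ j, (i.1 j = 0 → i.2 j = j) ∧ (i.1 j ≠ 0 → j < i.2 j))
    (c : Monom n → ℂ) (h : ∑ i ∈ S, c i • monomFun i = 0) : ∀ p ∈ S, c p = 0 := by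
  intro p hp
  -- Stage r: only the monomials that agree with p at the first r vertices remain, stripped of the
  -- factors there.
  have key : ∀ r : ℕ, r ≤ n → ∀ u : Config n,
      ∑ i ∈ S with ∀ j : Fin n, (j : ℕ) < r → i.1 j = p.1 j ∧ i.2 j = p.2 j,
        c i * ∏ j ∈ Finset.univ.filter fun j : Fin n => r ≤ (j : ℕ), (u.1 (i.2 j) - u.1 j)⁻¹ ^ i.1 j = 0 := by
    intro r
    induction r with
    | zero =>
      intro _ u
      have := congrFun h u
      simpa [monomFun, recip] using this
    | succ r ih =>
      intro hr u
      set s : Fin n := ⟨r, hr⟩ with hs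
      set T := S.filter fun i => ∀ j : Fin n, (j : ℕ) < r → i.1 j = p.1 j ∧ i.2 j = p.2 j with hT
      set Q : Monom n → ℂ := fun i =>
        ∏ j ∈ Finset.univ.filter fun j : Fin n => r + 1 ≤ (j : ℕ), (u.1 (i.2 j) - u.1 j)⁻¹ ^ i.1 j with hQ
      have hsplit : (Finset.univ.filter fun j : Fin n => r ≤ (j : ℕ)) =
          insert s (Finset.univ.filter fun j : Fin n => r + 1 ≤ (j : ℕ)) := by
        ext j
        simp only [Finset.mem_filter, Finset.mem_univ, true_and, Finset.mem_insert, hs, Fin.ext_iff]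
        omega
      have hle : ∀ i ∈ S, ∀ j, j ≤ i.2 j := fun i hi j => by
        by_cases h0 : i.1 j = 0
        · exact ((hS i hi j).1 h0).ge
        · exact ((hS i hi j).2 h0).le
      have hgroup : ∀ v : ℂ, v ∉ Set.range u.1 →
          ∑ i ∈ T, c i * Q i * (u.1 (i.2 s) - v)⁻¹ ^ i.1 s = 0 := by
        intro v hv
        have hinj : Function.Injective (Function.update u.1 s v) := by
          intro a b hab
          by_cases ha : a = s <;> by_cases hb : b = s
          · rw [ha, hb]
          · subst ha
            rw [Function.update_self, Function.update_of_ne hb] at hab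
            exact absurd ⟨b, hab.symm⟩ hv
          · subst hb
            rw [Function.update_self, Function.update_of_ne ha] at hab
            exact absurd ⟨a, hab⟩ hv
          · rw [Function.update_of_ne ha, Function.update_of_ne hb] at hab
            exact u.2 hab
        have := ih (by omega) ⟨_, hinj⟩
        rw [← this]
        refine Finset.sum_congr rfl fun i hi => ?_
        have hiS : i ∈ S := (Finset.mem_filter.1 hi).1
        rw [hsplit, Finset.prod_insert (by simp [hs]), mul_assoc, mul_comm (Q i)]
        congr 2
        -- With exponent 0 the target is s itself and the two bases may differ, but both powers are
        -- 1.
        · by_cases h0 : i.1 s = 0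
          · rw [h0, pow_zero, pow_zero]
          · have := (hS i hiS s).2 h0
            dsimp only
            rw [Function.update_self, Function.update_of_ne this.ne']
        · refine Finset.prod_congr rfl fun j hj => ?_
          have hj' : s < j := by
            simp only [Finset.mem_filter, Finset.mem_univ, true_and] at hj
            exact hj
          dsimp only
          rw [Function.update_of_ne hj'.ne', Function.update_of_ne (hj'.trans_le (hle i hiS j)).ne']
      have hpf := partialFraction_unique u s (T.image fun i => (i.1 s, i.2 s))
        (by
          intro o ho h0
          obtain ⟨i, hi, rfl⟩ := Finset.mem_image.1 ho
          exact (hS i (Finset.mem_filter.1 hi).1 s).1 h0)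
        (fun o => ∑ i ∈ T with (i.1 s, i.2 s) = o, c i * Q i)
        (by
          intro v hv
          rw [← hgroup v hv, ← Finset.sum_fiberwise_of_maps_to
            (g := fun i : Monom n => (i.1 s, i.2 s)) (fun i hi => Finset.mem_image_of_mem _ hi)]
          refine Finset.sum_congr rfl fun o _ => ?_
          rw [Finset.sum_mul]
          refine Finset.sum_congr rfl fun i hi => ?_
          rw [← (Finset.mem_filter.1 hi).2])
        (p.1 s, p.2 s) (Finset.mem_image.2 ⟨p, Finset.mem_filter.2 ⟨hp, fun _ _ => ⟨rfl, rfl⟩⟩, rfl⟩)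
      rw [← hpf]
      refine Finset.sum_congr ?_ fun i _ => rfl
      ext i
      simp only [hT, Finset.mem_filter, Prod.mk.injEq, and_assoc]
      refine and_congr_right fun _ => ⟨fun H => ⟨fun j hj => H j (by omega), H s (by simp [hs])⟩,
        fun H j hj => ?_⟩
      by_cases hjr : (j : ℕ) < r
      · exact H.1 j hjr
      · have : j = s := Fin.ext (by simp only [hs]; omega)
        rw [this]
        exact H.2
  by_cases hne : Nonempty (Config n)
  · obtain ⟨u⟩ := hne
    have := key n le_rfl u
    rw [Finset.sum_eq_single p] at this
    · rw [Finset.prod_eq_one, mul_one] at this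
      · exact this
      · intro j hj
        exact absurd (Finset.mem_filter.1 hj).2 (not_le.2 j.2)
    · intro i hi hip
      refine (hip (Sigma.ext (Finsupp.ext fun j => ?_) (heq_of_eq (funext fun j => ?_)))).elim
      · exact ((Finset.mem_filter.1 hi).2 j j.2).1
      · exact ((Finset.mem_filter.1 hi).2 j j.2).2
    · intro h1
      exact absurd (Finset.mem_filter.2 ⟨hp, fun _ _ => ⟨rfl, rfl⟩⟩) h1
  · exact absurd ⟨⟨fun j => ((j : ℕ) : ℂ), fun a b hab => Fin.ext (Nat.cast_injective hab)⟩⟩ hne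

/-! ### Straightening of monomials along a perfect elimination ordering -/

/-- The possible targets of the vertex `j` in a monomial whose exponent at `j` is `e`, for the graph
in which `N j` is the set of larger neighbours of `j`. -/
def targets {n : ℕ} (N : Fin n → Finset (Fin n)) (j : Fin n) (e : ℕ) : Finset (Fin n) :=
  if e = 0 then {j} else N j

theorem targets_zero {n : ℕ} (N : Fin n → Finset (Fin n)) (j : Fin n) : targets N j 0 = {j} :=
  if_pos rfl

theorem targets_of_ne_zero {n : ℕ} (N : Fin n → Finset (Fin n)) (j : Fin n) {e : ℕ} (he : e ≠ 0) :
    targets N j e = N j :=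
  if_neg he

/-- The monomials of degree `q` with at most one neighbour for each vertex. -/
def standardMonoms {n : ℕ} (N : Fin n → Finset (Fin n)) (q : ℕ) : Finset (Monom n) :=
  (Finset.finsuppAntidiag Finset.univ q).sigma fun e =>
    Fintype.piFinset fun j => targets N j (e j)

theorem mem_standardMonoms {n : ℕ} {N : Fin n → Finset (Fin n)} {q : ℕ} {i : Monom n} :
    i ∈ standardMonoms N q ↔ ∑ j, i.1 j = q ∧ ∀ j, i.2 j ∈ targets N j (i.1 j) := by
  simp [standardMonoms, Finset.mem_finsuppAntidiag, Fintype.mem_piFinset]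

theorem card_standardMonoms {n : ℕ} (N : Fin n → Finset (Fin n)) (q : ℕ) :
    ((standardMonoms N q).card : ℚ) =
      ∑ e ∈ Finset.finsuppAntidiag Finset.univ q, ∏ j, if e j = 0 then 1 else ((N j).card : ℚ) := by
  rw [standardMonoms, Finset.card_sigma]
  push_cast
  refine Finset.sum_congr rfl fun e _ => ?_
  rw [Fintype.card_piFinset]
  push_cast
  refine Finset.prod_congr rfl fun j _ => ?_
  rw [targets]
  split_ifs <;> simp

/-- The span of the standard monomials of degree `q`. -/
noncomputable def standardSpan {n : ℕ} (N : Fin n → Finset (Fin n)) (q : ℕ) :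
    Submodule ℂ (Config n → ℂ) :=
  Submodule.span ℂ (monomFun '' (standardMonoms N q : Set (Monom n)))

theorem linearIndependent_standardMonoms {n : ℕ} {N : Fin n → Finset (Fin n)}
    (hN : ∀ j, ∀ l ∈ N j, j < l) (q : ℕ) :
    LinearIndependent ℂ fun i : standardMonoms N q => monomFun i.1 := by
  classical
  refine linearIndependent_iff'.2 fun s c hc i hi => ?_
  have := monomFun_coeff_eq_zero (s.map (Function.Embedding.subtype _))
    (fun p hp j => by
      obtain ⟨⟨p, hpN⟩, -, rfl⟩ := Finset.mem_map.1 hp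
      have hj := (mem_standardMonoms.1 hpN).2 j
      refine ⟨fun h0 => ?_, fun h0 => ?_⟩
      · simp only [Function.Embedding.subtype_apply] at h0 ⊢
        rwa [h0, targets_zero, Finset.mem_singleton] at hj
      · simp only [Function.Embedding.subtype_apply] at h0 ⊢
        rw [targets_of_ne_zero _ _ h0] at hj
        exact hN _ _ hj)
    (fun p => if h : p ∈ standardMonoms N q then c ⟨p, h⟩ else 0)
    (by
      rw [Finset.sum_map, ← hc]
      refine Finset.sum_congr rfl fun p _ => ?_
      simp) i.1 (Finset.mem_map_of_mem _ hi)
  simpa using this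

theorem finrank_standardSpan {n : ℕ} {N : Fin n → Finset (Fin n)}
    (hN : ∀ j, ∀ l ∈ N j, j < l) (q : ℕ) :
    Module.finrank ℂ (standardSpan N q) = (standardMonoms N q).card := by
  have := finrank_span_eq_card (linearIndependent_standardMonoms hN q)
  rw [Fintype.card_coe] at this
  rw [← this, standardSpan, Set.image_eq_range]
  rfl

/-- Replace the exponent and the target of one vertex. -/
noncomputable def Monom.set {n : ℕ} (i : Monom n) (j : Fin n) (e : ℕ) (l : Fin n) : Monom n :=
  ⟨i.1.update j e, Function.update i.2 j l⟩

/-- `hq` is the degree balance q' = q - i_j + e, written without subtraction. -/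
theorem Monom.set_mem {n : ℕ} {N : Fin n → Finset (Fin n)} {q q' e : ℕ} {i : Monom n} {j l : Fin n}
    (hi : i ∈ standardMonoms N q) (hl : l ∈ targets N j e) (hq : q + e = q' + i.1 j) :
    i.set j e l ∈ standardMonoms N q' := by
  rw [mem_standardMonoms] at hi ⊢
  refine ⟨?_, fun k => ?_⟩
  · have h1 := Finset.add_sum_erase Finset.univ (fun k => i.1 k) (Finset.mem_univ j)
    have h2 := Finset.add_sum_erase Finset.univ (fun k => (i.set j e l).1 k) (Finset.mem_univ j)
    have h3 : ∑ k ∈ Finset.univ.erase j, (i.set j e l).1 k = ∑ k ∈ Finset.univ.erase j, i.1 k :=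
      Finset.sum_congr rfl fun k hk => by
        simp [Monom.set, Function.update_of_ne (Finset.ne_of_mem_erase hk)]
    have h4 : (i.set j e l).1 j = e := by simp [Monom.set]
    simp only [h3, h4] at h2
    simp only [hi.1] at h1
    omega
  · by_cases hk : k = j
    · subst hk
      simpa [Monom.set] using hl
    · simpa [Monom.set, Function.update_of_ne hk] using hi.2 k

theorem monomFun_set {n : ℕ} (i : Monom n) (j : Fin n) (e : ℕ) (l : Fin n) :
    monomFun (i.set j e l) =
      recip j l ^ e * ∏ k ∈ Finset.univ.erase j, recip k (i.2 k) ^ i.1 k := by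
  rw [monomFun, ← Finset.mul_prod_erase _ _ (Finset.mem_univ j)]
  congr 1
  · simp [Monom.set]
  · refine Finset.prod_congr rfl fun k hk => ?_
    simp [Monom.set, Function.update_of_ne (Finset.ne_of_mem_erase hk)]

theorem monomFun_eq {n : ℕ} (i : Monom n) (j : Fin n) :
    monomFun i =
      recip j (i.2 j) ^ i.1 j * ∏ k ∈ Finset.univ.erase j, recip k (i.2 k) ^ i.1 k := by
  rw [monomFun, ← Finset.mul_prod_erase _ _ (Finset.mem_univ j)]

theorem monomFun_mem {n : ℕ} {N : Fin n → Finset (Fin n)} {q : ℕ} {i : Monom n}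
    (hi : i ∈ standardMonoms N q) : monomFun i ∈ standardSpan N q :=
  Submodule.subset_span ⟨i, hi, rfl⟩

/-- The relation of a triangle: two factors at j are traded for one at j and one on the opposite
edge. -/
theorem recip_mul_recip {n : ℕ} {j a l : Fin n} (ha : j ≠ a) (hl : j ≠ l) (hal : a ≠ l) :
    recip j l * recip j a = recip a l * (recip j a - recip j l) := by
  funext u
  have h1 : u.1 l - u.1 j ≠ 0 := sub_ne_zero.2 fun h => hl (u.2 h).symm
  have h2 : u.1 a - u.1 j ≠ 0 := sub_ne_zero.2 fun h => ha (u.2 h).symm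
  have h3 : u.1 l - u.1 a ≠ 0 := sub_ne_zero.2 fun h => hal (u.2 h).symm
  simp only [recip, Pi.mul_apply, Pi.sub_apply]
  field_simp
  ring

theorem recip_swap {n : ℕ} (j l : Fin n) : recip l j = - recip j l := by
  funext u
  simp only [recip, Pi.neg_apply]
  rw [← inv_neg, neg_sub]

/-- Multiplication by `1 / (u_l - u_j)` preserves the span of the standard monomials, if the larger
neighbours of each vertex form a clique. -/
theorem recip_mul_mem {n : ℕ} {N : Fin n → Finset (Fin n)} (hN : ∀ j, ∀ l ∈ N j, j < l)
    (hclique : ∀ j, ∀ a ∈ N j, ∀ l ∈ N j, a < l → l ∈ N a) (j : Fin n) :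
    ∀ l ∈ N j, ∀ (q : ℕ), ∀ f ∈ standardSpan N q, recip j l * f ∈ standardSpan N (q + 1) := by
  -- Straightening moves factors to larger vertices, so the induction descends from the largest
  -- vertex; inside it, there is an induction on the exponent at j.
  induction j using WellFoundedGT.induction with
  | ind j ihj =>
  intro l hl
  have hbasis : ∀ (e q : ℕ) (i : Monom n), i ∈ standardMonoms N q → i.1 j = e →
      recip j l * monomFun i ∈ standardSpan N (q + 1) := by
    intro e
    induction e with
    | zero =>
      intro q i hi he
      have hmem : i.set j 1 l ∈ standardMonoms N (q + 1) :=
        Monom.set_mem hi (by rwa [targets_of_ne_zero _ _ one_ne_zero]) (by omega)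
      have := monomFun_mem hmem
      rwa [monomFun_set, pow_one, ← one_mul (∏ k ∈ _, _), ← pow_zero (recip j (i.2 j)), ← he,
        ← monomFun_eq] at this
    | succ e ihe =>
      intro q i hi he
      have hij : i.2 j ∈ N j := by
        have := (mem_standardMonoms.1 hi).2 j
        rwa [targets_of_ne_zero _ _ (by omega)] at this
      by_cases hil : i.2 j = l
      · have hmem : i.set j (e + 2) l ∈ standardMonoms N (q + 1) :=
          Monom.set_mem hi (by rwa [targets_of_ne_zero _ _ (by omega)]) (by omega)
        have := monomFun_mem hmem
        rwa [monomFun_set, pow_succ', mul_assoc, ← he, ← hil, ← monomFun_eq, hil] at this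
      · obtain ⟨q, rfl⟩ : ∃ q', q = q' + 1 := by
          have h1 := (mem_standardMonoms.1 hi).1
          have h2 : i.1 j ≤ ∑ k, i.1 k :=
            Finset.single_le_sum (f := fun k => i.1 k) (fun _ _ => Nat.zero_le _)
              (Finset.mem_univ j)
          exact ⟨q - 1, by omega⟩
        -- i' is i with one factor at j removed; if none is left, the target has to be reset to j.
        obtain ⟨i', hi', hi'j, hprod⟩ : ∃ i' ∈ standardMonoms N q, i'.1 j = e ∧
            monomFun i = recip j (i.2 j) * monomFun i' := by
          rcases Nat.eq_zero_or_pos e with he0 | he0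
          · refine ⟨i.set j e j, Monom.set_mem hi (by simp [he0, targets_zero]) (by omega),
              by simp [Monom.set], ?_⟩
            rw [monomFun_set, monomFun_eq i j, he, he0]
            simp
          · refine ⟨i.set j e (i.2 j), Monom.set_mem hi
              (by rwa [targets_of_ne_zero _ _ he0.ne']) (by omega), by simp [Monom.set], ?_⟩
            rw [monomFun_set, monomFun_eq i j, he, pow_succ', mul_assoc]
        have hfirst := monomFun_mem hi
        have hsecond := ihe q i' hi' hi'j
        have hdiff := Submodule.sub_mem _ hfirst hsecond
        have hexp : recip j l * monomFun i =
            recip (i.2 j) l * (monomFun i - recip j l * monomFun i') := by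
          rw [hprod, ← mul_assoc, recip_mul_recip (hN _ _ hij).ne (hN _ _ hl).ne hil]
          ring
        rw [hexp]
        -- The bracket is already in the span; by the clique condition the remaining factor belongs
        -- to an edge whose smaller end exceeds j.
        rcases lt_or_gt_of_ne hil with hlt | hlt
        · exact ihj _ (hN _ _ hij) l (hclique j _ hij _ hl hlt) _ _ hdiff
        · rw [recip_swap, neg_mul]
          exact Submodule.neg_mem _ (ihj _ (hN _ _ hl) _ (hclique j _ hl _ hij hlt) _ _ hdiff)
  intro q f hf
  induction hf using Submodule.span_induction with
  | mem f hf =>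
    obtain ⟨i, hi, rfl⟩ := hf
    exact hbasis _ q i hi rfl
  | zero => rw [mul_zero]; exact Submodule.zero_mem _
  | add f g _ _ hf hg => rw [mul_add]; exact Submodule.add_mem _ hf hg
  | smul c f _ hf => rw [mul_smul_comm]; exact Submodule.smul_mem _ _ hf

theorem one_mem_standardSpan {n : ℕ} (N : Fin n → Finset (Fin n)) : 1 ∈ standardSpan N 0 := by
  have : (⟨0, id⟩ : Monom n) ∈ standardMonoms N 0 := by
    rw [mem_standardMonoms]
    simp [targets_zero]
  simpa [monomFun] using monomFun_mem this

theorem recip_pow_mul_mem {n : ℕ} {N : Fin n → Finset (Fin n)} (hN : ∀ j, ∀ l ∈ N j, j < l)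
    (hclique : ∀ j, ∀ a ∈ N j, ∀ l ∈ N j, a < l → l ∈ N a) {j l : Fin n} (hl : l ∈ N j)
    (k : ℕ) {q : ℕ} {f : Config n → ℂ} (hf : f ∈ standardSpan N q) :
    recip j l ^ k * f ∈ standardSpan N (k + q) := by
  induction k with
  | zero => simpa using hf
  | succ k ih =>
    rw [pow_succ', mul_assoc, add_right_comm]
    exact recip_mul_mem hN hclique j l hl _ _ ih

open MvPolynomial in
/-- The forms of degree `q` in the functions `1 / (u_l - u_j)`, over the edges of a graph for which
the vertex order is a perfect elimination ordering, are spanned by the standard monomials. -/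
theorem map_homogeneousSubmodule_eq {n : ℕ} {ι : Type*} {N : Fin n → Finset (Fin n)}
    (hN : ∀ j, ∀ l ∈ N j, j < l) (hclique : ∀ j, ∀ a ∈ N j, ∀ l ∈ N j, a < l → l ∈ N a)
    (bot top : ι → Fin n) (hedge : ∀ c, top c ∈ N (bot c))
    (hsurj : ∀ j, ∀ l ∈ N j, ∃ c, bot c = j ∧ top c = l) (q : ℕ) :
    (homogeneousSubmodule ι ℂ q).map
      (aeval (R := ℂ) fun c => recip (bot c) (top c)).toLinearMap = standardSpan N q := by
  apply le_antisymm
  · rintro _ ⟨f, hf, rfl⟩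
    have hmono : ∀ (s : ι →₀ ℕ) (T : Finset ι),
        ∏ c ∈ T, recip (bot c) (top c) ^ s c ∈ standardSpan N (∑ c ∈ T, s c) := by
      classical
      intro s T
      induction T using Finset.induction_on with
      | empty => simpa using one_mem_standardSpan N
      | insert c T hc ih =>
        rw [Finset.prod_insert hc, Finset.sum_insert hc]
        exact recip_pow_mul_mem hN hclique (hedge c) _ ih
    rw [AlgHom.toLinearMap_apply, aeval_def, eval₂_eq]
    refine Submodule.sum_mem _ fun s hs => ?_
    rw [← Algebra.smul_def]
    refine Submodule.smul_mem _ _ ?_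
    have hdeg : ∑ c ∈ s.support, s c = q := by
      have := hf (mem_support_iff.1 hs)
      rw [← this, Finsupp.weight_apply, Finsupp.sum]
      simp
    rw [← hdeg]
    exact hmono s s.support
  · refine Submodule.span_le.2 ?_
    rintro _ ⟨i, hi, rfl⟩
    obtain ⟨hq, hi⟩ := mem_standardMonoms.1 hi
    have hfac : ∀ j, ∃ f : MvPolynomial ι ℂ, f.IsHomogeneous (i.1 j) ∧
        aeval (R := ℂ) (fun c => recip (bot c) (top c)) f = recip j (i.2 j) ^ i.1 j := by
      intro j
      by_cases h0 : i.1 j = 0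
      · exact ⟨1, by rw [h0]; exact isHomogeneous_one _ _, by rw [h0, pow_zero, map_one]⟩
      · have := hi j
        rw [targets_of_ne_zero _ _ h0] at this
        obtain ⟨c, hc, hc'⟩ := hsurj j _ this
        exact ⟨X c ^ i.1 j, by simpa using (isHomogeneous_X ℂ c).pow (i.1 j),
          by rw [map_pow, aeval_X, hc, hc']⟩
    choose f hf hf' using hfac
    refine ⟨∏ j, f j, ?_, ?_⟩
    · rw [← hq]
      exact IsHomogeneous.prod _ _ _ fun j _ => hf j
    · rw [AlgHom.toLinearMap_apply, map_prod, monomFun]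
      exact Finset.prod_congr rfl fun j _ => hf' j

/-! ### The reciprocal linear space in terms of configurations of points -/

theorem eval_smul_of_isHomogeneous {ι : Type*} {f : MvPolynomial ι ℂ} {q : ℕ}
    (hf : f.IsHomogeneous q) (a : ℂ) (v : ι → ℂ) :
    MvPolynomial.eval (a • v) f = a ^ q * MvPolynomial.eval v f := by
  rw [MvPolynomial.eval_eq, MvPolynomial.eval_eq, Finset.mul_sum]
  refine Finset.sum_congr rfl fun s hs => ?_
  have hdeg : ∑ c ∈ s.support, s c = q := by
    have := hf (MvPolynomial.mem_support_iff.1 hs)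
    rw [← this, Finsupp.weight_apply, Finsupp.sum]
    simp
  simp only [Pi.smul_apply, smul_eq_mul, mul_pow, Finset.prod_mul_distrib,
    Finset.prod_pow_eq_pow_sum, hdeg]
  ring

theorem eval_eq_zero_of_mk_eq {ι : Type*} {f : MvPolynomial ι ℂ} {q : ℕ}
    (hf : f.IsHomogeneous q) {v w : ι → ℂ} (hv : v ≠ 0) (hw : w ≠ 0)
    (h : Projectivization.mk ℂ v hv = Projectivization.mk ℂ w hw)
    (h0 : MvPolynomial.eval w f = 0) : MvPolynomial.eval v f = 0 := by
  obtain ⟨a, rfl⟩ := (Projectivization.mk_eq_mk_iff' ℂ v w hv hw).1 h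
  rw [eval_smul_of_isHomogeneous hf, h0, mul_zero]

/-- Taking the closure adds no condition on forms, by its very definition; homogeneity makes
vanishing independent of the representative. -/
theorem mem_homogeneousIdeal_zariskiClosure_iff {ι : Type*}
    (V : Set (Projectivization ℂ (ι → ℂ))) {f : MvPolynomial ι ℂ} {q : ℕ}
    (hf : f.IsHomogeneous q) :
    f ∈ homogeneousIdeal (zariskiClosure V) ↔ ∀ v ∈ coneOver V, MvPolynomial.eval v f = 0 := by
  rw [homogeneousIdeal, MvPolynomial.mem_vanishingIdeal_iff]
  simp only [MvPolynomial.aeval_eq_eval]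
  constructor
  · rintro h v ⟨hv, hvV⟩
    exact h v ⟨hv, fun q g _ hgV => hgV _ hvV⟩
  · rintro h v ⟨hv, hvV⟩
    refine eval_eq_zero_of_mk_eq hf hv (Projectivization.rep_nonzero _)
      (Projectivization.mk_rep _).symm (hvV q f hf fun w hw => h _ ?_)
    exact ⟨w.rep_nonzero, by rwa [Projectivization.mk_rep]⟩

/-- Both images are quotients of p by the same kernel. This replaces the coordinate ring by an
algebra of functions on configurations. -/
theorem finrank_map_congr {E F G : Type*} [AddCommGroup E] [Module ℂ E] [AddCommGroup F]
    [Module ℂ F] [AddCommGroup G] [Module ℂ G] (p : Submodule ℂ E) (f : E →ₗ[ℂ] F) (g : E →ₗ[ℂ] G)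
    (h : ∀ x ∈ p, f x = 0 ↔ g x = 0) :
    Module.finrank ℂ (p.map f) = Module.finrank ℂ (p.map g) := by
  have hker : LinearMap.ker (f.domRestrict p) = LinearMap.ker (g.domRestrict p) := by
    ext x
    simpa using h x.1 x.2
  rw [← LinearMap.range_domRestrict, ← LinearMap.range_domRestrict]
  exact ((f.domRestrict p).quotKerEquivRange.symm.trans
    ((Submodule.quotEquivOfEq _ _ hker).trans (g.domRestrict p).quotKerEquivRange)).finrank_eq

/-! ### The graph and the configurations attached to `matrixL`. -/

/-- The graph on `d + 2` vertices in which only the edge between the first two is missing: the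
larger neighbours of the vertex `j`. -/
def largerNeighbors (d : ℕ) (j : Fin (d + 2)) : Finset (Fin (d + 2)) :=
  Finset.univ.filter fun l => j < l ∧ 2 ≤ (l : ℕ)

theorem mem_largerNeighbors {d : ℕ} {j l : Fin (d + 2)} :
    l ∈ largerNeighbors d j ↔ j < l ∧ 2 ≤ (l : ℕ) := by
  simp [largerNeighbors]

/-- The smaller end of the edge that belongs to a column of `matrixL m`. -/
def Column.bot {m : ℕ} (c : Column m) : Fin (m - 3 + 2) := ⟨c.2, by omega⟩

/-- The larger end of the edge that belongs to a column of `matrixL m`. -/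
def Column.top {m : ℕ} (c : Column m) : Fin (m - 3 + 2) := ⟨c.1 + 2, by omega⟩

theorem Column.top_mem {m : ℕ} (c : Column m) : c.top ∈ largerNeighbors (m - 3) c.bot :=
  mem_largerNeighbors.2 ⟨c.2.2, Nat.le_add_left _ _⟩

theorem exists_column {m : ℕ} (j l : Fin (m - 3 + 2)) (h : l ∈ largerNeighbors (m - 3) j) :
    ∃ c : Column m, c.bot = j ∧ c.top = l := by
  obtain ⟨h1, h2⟩ := mem_largerNeighbors.1 h
  refine ⟨⟨⟨l - 2, by omega⟩, ⟨j, ?_⟩⟩, rfl, ?_⟩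
  · have : (j : ℕ) < l := h1
    simp only
    omega
  · ext
    simp only [Column.top]
    omega

theorem affineForm_matrixL {m : ℕ} (x : Fin (m - 3) → ℂ) (c : Column m) :
    affineForm (matrixL m) x c =
      (Fin.cons 0 (Fin.cons 1 x : Fin (m - 3 + 1) → ℂ) : Fin (m - 3 + 2) → ℂ) c.top -
        (Fin.cons 0 (Fin.cons 1 x : Fin (m - 3 + 1) → ℂ) : Fin (m - 3 + 2) → ℂ) c.bot := by
  set w : Fin (m - 3 + 1) → ℂ := Fin.cons 1 x with hw
  obtain ⟨⟨k, hk⟩, ⟨j, hj⟩⟩ := c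
  have hsplit : ∀ i : Fin (m - 3 + 1), w i * matrixL m i ⟨⟨k, hk⟩, ⟨j, hj⟩⟩ =
      (if i = ⟨k + 1, by omega⟩ then w i else 0) - (if (i : ℕ) + 1 = j then w i else 0) := by
    intro i
    simp only at hj
    simp only [matrixL, Fin.ext_iff]
    split_ifs <;> first | omega | ring
  rw [affineForm, Matrix.vecMul, dotProduct, ← hw]
  simp_rw [hsplit]
  rw [Finset.sum_sub_distrib, Finset.sum_ite_eq' Finset.univ, if_pos (Finset.mem_univ _)]
  congr 1
  -- For j = 0 no row carries the entry -1, in accordance with the smaller end being the point 0.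
  rcases j with _ | j
  · simp [Column.bot]
  · simp only at hj
    rw [Finset.sum_eq_single (⟨j, by omega⟩ : Fin (m - 3 + 1))]
    · simp only [if_true]
      rfl
    · intro i _ hi
      rw [if_neg]
      intro h
      exact hi (Fin.ext (by simp only; omega))
    · simp

theorem injective_of_mem_complement {m : ℕ} {x : Fin (m - 3) → ℂ}
    (hx : x ∈ complement (matrixL m)) : Function.Injective
      (Fin.cons 0 (Fin.cons 1 x : Fin (m - 3 + 1) → ℂ) : Fin (m - 3 + 2) → ℂ) := by
  set u : Fin (m - 3 + 2) → ℂ := Fin.cons 0 (Fin.cons 1 x : Fin (m - 3 + 1) → ℂ) with hu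
  have hlt : ∀ a b : Fin (m - 3 + 2), a < b → u a ≠ u b := by
    intro a b hab
    by_cases hb : 2 ≤ (b : ℕ)
    · obtain ⟨c, rfl, rfl⟩ := exists_column a b (mem_largerNeighbors.2 ⟨hab, hb⟩)
      have := hx c
      rw [affineForm_matrixL] at this
      exact (sub_ne_zero.1 this).symm
    -- The one pair that is not an edge: its points are 0 and 1.
    · have hab' : (a : ℕ) < b := hab
      have h0 : a = 0 := Fin.ext (by simp only [Fin.val_zero]; omega)
      have h1 : b = Fin.succ 0 := Fin.ext (by simp only [Fin.val_succ, Fin.val_zero]; omega)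
      rw [h0, h1, hu, Fin.cons_succ, Fin.cons_zero, Fin.cons_zero]
      exact zero_ne_one
  intro a b hab
  by_contra hne
  rcases lt_or_gt_of_ne hne with h | h
  · exact hlt a b h hab
  · exact hlt b a h hab.symm

theorem exists_column_of_four_le {m : ℕ} (hm : 4 ≤ m) : Nonempty (Column m) :=
  ⟨⟨⟨0, by omega⟩, 0⟩⟩

/-- An affine map of the plane sends u_0 to 0 and u_1 to 1. Translation preserves differences, and
scaling multiplies all reciprocals by one constant, which a form absorbs. This frees the first two
points as well. -/
theorem forall_coneOver_reciprocalImage_iff {m : ℕ} (hm : 4 ≤ m) {f : MvPolynomial (Column m) ℂ}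
    {q : ℕ} (hf : f.IsHomogeneous q) :
    (∀ v ∈ coneOver (reciprocalImage (matrixL m)), MvPolynomial.eval v f = 0) ↔
      ∀ u : Config (m - 3 + 2),
        MvPolynomial.eval (fun c : Column m => recip c.bot c.top u) f = 0 := by
  obtain ⟨c₀⟩ := exists_column_of_four_le hm
  constructor
  · intro h u
    set t : ℂ := u.1 (Fin.succ 0) - u.1 0 with ht
    have ht0 : t ≠ 0 := sub_ne_zero.2 (u.2.ne (Fin.succ_ne_zero 0))
    set x : Fin (m - 3) → ℂ := fun j => (u.1 j.succ.succ - u.1 0) / t with hx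
    have hux : (Fin.cons 0 (Fin.cons 1 x : Fin (m - 3 + 1) → ℂ) : Fin (m - 3 + 2) → ℂ) =
        fun j => (u.1 j - u.1 0) / t := by
      funext j
      refine Fin.cases ?_ (fun j => Fin.cases ?_ (fun j => ?_) j) j
      · simp
      · rw [Fin.cons_succ, Fin.cons_zero, ← ht, div_self ht0]
      · rw [Fin.cons_succ, Fin.cons_succ]
    have hform : ∀ c : Column m, affineForm (matrixL m) x c = (u.1 c.top - u.1 c.bot) / t := by
      intro c
      rw [affineForm_matrixL, hux]
      ring
    have hne : ∀ c : Column m, u.1 c.top - u.1 c.bot ≠ 0 := fun c =>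
      sub_ne_zero.2 (u.2.ne (mem_largerNeighbors.1 c.top_mem).1.ne')
    have hsmul : (fun c : Column m => recip c.bot c.top u) =
        t⁻¹ • fun c => (affineForm (matrixL m) x c)⁻¹ := by
      funext c
      rw [Pi.smul_apply, hform, inv_div, smul_eq_mul, recip]
      field_simp
    have hv : (fun c => (affineForm (matrixL m) x c)⁻¹) ≠ 0 := by
      intro h0
      have := congrFun h0 c₀
      rw [hform, Pi.zero_apply, inv_eq_zero] at this
      exact div_ne_zero (hne c₀) ht0 this
    rw [hsmul, eval_smul_of_isHomogeneous hf, h _ ⟨hv, x, ?_, hv, rfl⟩, mul_zero]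
    intro c
    rw [hform]
    exact div_ne_zero (hne c) ht0
  · rintro h v ⟨hv, x, hx, hx0, hvx⟩
    refine eval_eq_zero_of_mk_eq hf hv hx0 hvx ?_
    have := h ⟨_, injective_of_mem_complement hx⟩
    rw [← this]
    congr 2
    funext c
    rw [affineForm_matrixL]
    rfl

/-- The ordering is a perfect elimination ordering because larger neighbours have index at least 2
and any two such vertices are adjacent. -/
theorem hilbertFunction_eq_card {m : ℕ} (hm : 4 ≤ m) (q : ℕ) :
    hilbertFunction (reciprocalLinearSpace (matrixL m)) q =
      (standardMonoms (largerNeighbors (m - 3)) q).card := by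
  have hN : ∀ j, ∀ l ∈ largerNeighbors (m - 3) j, j < l :=
    fun j l hl => (mem_largerNeighbors.1 hl).1
  rw [← finrank_standardSpan hN, ← map_homogeneousSubmodule_eq hN
    (fun j a _ l hl hal => mem_largerNeighbors.2 ⟨hal, (mem_largerNeighbors.1 hl).2⟩)
    (Column.bot (m := m)) Column.top Column.top_mem exists_column q]
  refine finrank_map_congr _ _ _ fun f hf => ?_
  have hf : f.IsHomogeneous q := hf
  rw [AlgHom.toLinearMap_apply, AlgHom.toLinearMap_apply, Ideal.Quotient.mkₐ_eq_mk,
    Ideal.Quotient.eq_zero_iff_mem, reciprocalLinearSpace,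
    mem_homogeneousIdeal_zariskiClosure_iff _ hf, forall_coneOver_reciprocalImage_iff hm hf,
    funext_iff]
  refine forall_congr' fun u => ?_
  have : (Pi.evalAlgHom ℂ (fun _ : Config (m - 3 + 2) => ℂ) u).comp
      (MvPolynomial.aeval fun c : Column m => recip c.bot c.top) =
      MvPolynomial.aeval fun c : Column m => recip c.bot c.top u := by
    ext c
    simp
  have := DFunLike.congr_fun this f
  rw [AlgHom.comp_apply, Pi.evalAlgHom_apply, MvPolynomial.aeval_eq_eval] at this
  rw [this]
  rfl

/-! ### The Hilbert polynomial -/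

theorem card_largerNeighbors_zero (d : ℕ) : (largerNeighbors d 0).card = d := by
  have : largerNeighbors d 0 = Finset.univ.map ((Fin.addNatEmb 2 : Fin d ↪ Fin (d + 2))) := by
    ext l
    simp only [mem_largerNeighbors, Finset.mem_map, Finset.mem_univ, true_and, Fin.lt_def,
      Fin.val_zero]
    constructor
    · rintro ⟨_, h⟩
      exact ⟨⟨l - 2, by omega⟩, Fin.ext (by simp; omega)⟩
    · rintro ⟨k, rfl⟩
      simp
  rw [this, Finset.card_map, Finset.card_univ, Fintype.card_fin]

/-- From vertex 1 on, the condition 2 ≤ l follows from j < l. Hence vertices 0 and 1 both have d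
larger neighbours. -/
theorem card_largerNeighbors_succ (d : ℕ) (j : Fin (d + 1)) :
    (largerNeighbors d j.succ).card = d - j := by
  have : largerNeighbors d j.succ = Finset.Ioi j.succ := by
    ext l
    simp only [mem_largerNeighbors, Finset.mem_Ioi, Fin.lt_def, Fin.val_succ]
    omega
  rw [this, Fin.card_Ioi, Fin.val_succ]
  omega

theorem coeff_prod_blockSeries (d q : ℕ) :
    PowerSeries.coeff q (∏ j, blockSeries ((largerNeighbors d j).card : ℚ)) =
      ((standardMonoms (largerNeighbors d) q).card : ℚ) := by
  rw [PowerSeries.coeff_prod, card_standardMonoms]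
  simp [blockSeries]

theorem prod_card_largerNeighbors (d : ℕ) :
    ∏ j : Fin (d + 1), ((largerNeighbors d j.castSucc).card : ℚ) = ((d * d.factorial : ℕ) : ℚ) := by
  rw [Fin.prod_univ_succ, Fin.castSucc_zero, card_largerNeighbors_zero, Nat.cast_mul]
  congr 1
  rw [← Nat.cast_prod, Nat.cast_inj]
  have : ∀ j : Fin d, (largerNeighbors d j.succ.castSucc).card = d - j := fun j =>
    card_largerNeighbors_succ d j.castSucc
  simp_rw [this]
  rw [Fin.prod_univ_eq_prod_range (fun j => d - j), ← Nat.descFactorial_eq_prod_range,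
    Nat.descFactorial_self]

theorem degree_reciprocalLinearSpace_matrixL {m : ℕ} (hm : 4 ≤ m) :
    degree (reciprocalLinearSpace (matrixL m)) = ((m - 3) * Nat.factorial (m - 3) : ℕ) := by
  set d := m - 3 with hd
  set p : Polynomial ℚ := ∏ j : Fin (d + 1),
    (1 + Polynomial.C (((largerNeighbors d j.castSucc).card : ℚ) - 1) * Polynomial.X) with hp
  have heval : p.eval 1 = ((d * d.factorial : ℕ) : ℚ) := by
    rw [← prod_card_largerNeighbors, hp, Polynomial.eval_prod]
    simp
  have hne : p.eval 1 ≠ 0 := by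
    rw [heval, Nat.cast_ne_zero]
    exact mul_ne_zero (by omega) (Nat.factorial_ne_zero d)
  -- The last vertex has no larger neighbour. Writing its factor 1 as (1 - X)/(1 - X) would make the
  -- numerator vanish at 1, so it is dropped, which leaves d + 1 factors.
  have hlast : blockSeries ((largerNeighbors d (Fin.last (d + 1))).card : ℚ) = 1 := by
    rw [← Fin.succ_last, card_largerNeighbors_succ, Fin.val_last, Nat.sub_self, Nat.cast_zero,
      blockSeries_zero]
  rw [degree_eq_of_eventually _ (p.hilbertPoly (d + 1)), factorial_mul_leadingCoeff_hilbertPoly hne,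
    heval]
  -- The coefficients of p/(1 - X)^(d+1) are matched with the polynomial values for q beyond the
  -- degree of p.
  filter_upwards [Filter.eventually_gt_atTop p.natDegree] with q hq
  rw [hilbertFunction_eq_card hm, ← Polynomial.coeff_mul_invOneSubPow_eq_hilbertPoly_eval _ hq,
    ← coeff_prod_blockSeries, Fin.prod_univ_castSucc, hlast, mul_one, prod_blockSeries_eq]

end ScatteringArrangement

theorem proposition5p1 (m : ℕ) (hm : 4 ≤ m) :
    ScatteringArrangement.degree
        (ScatteringArrangement.reciprocalLinearSpace (ScatteringArrangement.matrixL m)) =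
      ((m - 3) * Nat.factorial (m - 3) : ℕ) :=
  ScatteringArrangement.degree_reciprocalLinearSpace_matrixL hm
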